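/- There is an absolute constant $c>0$ such that the following holds for every prime $p$, all integers $1\le k<n$, and every finite set $X$ with $|X|\ge p^{n-k}$. In the generalized Simon problem $\mathsf{GSP}(p,n,k)$ one has query access to an unknown function $f:\mathbb{Z}_p^n\to X$ for which there is a subgroup $S\le\mathbb{Z}_p^n$ of rank $k$ such that, for all $x,y\in\mathbb{Z}_p^n$, $f(x)=f(y)$ if and only if $x-y\in S$; the task is to output $S$. A deterministic algorithm is an (adaptive) decision tree which queries values of $f$; a randomized algorithm is a probability distribution over such trees. Then: 1. every deterministic algorithm that outputs $S$ correctly on every such input $f$ makes, in the worst case, at least $c\cdot\max\{k,\sqrt{p^{n-k}}\}$ queries; 2. for every $0\le\varepsilon<1/2$, every randomized algorithm that outputs $S$ with probability at least $1-\varepsilon$ on every such input $f$ makes, in the worst case over inputs and coin tosses, at least $c\cdot\max\{k,\sqrt{p^{n-k}}\}$ queries. That is, every classical deterministic or bounded-error randomized algorithm for $\mathsf{GSP}(p,n,k)$ needs $\Omega(\max\{k,\sqrt{p^{n-k}}\})$ queries. -/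

import Mathlib

namespace GSP

/-- A deterministic classical (adaptive) query algorithm, i.e. a decision tree, which queries a
function `f : D → X` at points of `D`, branches on the answers, and finally outputs an element
of `R`. -/
inductive DecisionTree (D X R : Type*) where
  /-- Stop and output `r`. -/
  | output (r : R) : DecisionTree D X R
  /-- Query the function at `x`, then continue according to the answer. -/
  | query (x : D) (next : X → DecisionTree D X R) : DecisionTree D X R

namespace DecisionTree

variable {D X R : Type*}

/-- The output of the algorithm when the queried function is `f`. -/
def run (f : D → X) : DecisionTree D X R → R
  | output r => r
  | query x next => (next (f x)).run f

/-- The number of queries that the algorithm makes when the queried function is `f`. -/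
def numQueries (f : D → X) : DecisionTree D X R → ℕ
  | output _ => 0
  | query x next => (next (f x)).numQueries f + 1

end DecisionTree

/-- The rank of a subgroup of `ℤ_p^n`: the number of elements of a basis over `ℤ_p`. -/
noncomputable def rank {p n : ℕ} (S : AddSubgroup (Fin n → ZMod p)) : ℕ :=
  Module.finrank (ZMod p) (AddSubgroup.toZModSubmodule p S)

/-- The promise of the generalized Simon problem: `S` is a subgroup of `ℤ_p^n` of rank `k`, and
`f x = f y` if and only if `x - y ∈ S`. -/
def Promise {p n : ℕ} {X : Type*} (k : ℕ) (f : (Fin n → ZMod p) → X)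
    (S : AddSubgroup (Fin n → ZMod p)) : Prop :=
  rank S = k ∧ ∀ x y, f x = f y ↔ x - y ∈ S

/-- Deterministic query algorithms for the generalized Simon problem: the queried function is
`f : ℤ_p^n → X`, the output is a subgroup of `ℤ_p^n`. -/
abbrev DetAlgorithm (p n : ℕ) (X : Type*) :=
  DecisionTree (Fin n → ZMod p) X (AddSubgroup (Fin n → ZMod p))

/-- Randomized query algorithms: probability distributions over deterministic ones. (For finite
`X` there are only countably many decision trees, so every distribution is discrete.) -/
abbrev RandAlgorithm (p n : ℕ) (X : Type*) := PMF (DetAlgorithm p n X)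

namespace DetAlgorithm

variable {p n : ℕ} {X : Type*}

/-- The algorithm finds the hidden subgroup with certainty, on every input. -/
def Solves (A : DetAlgorithm p n X) (k : ℕ) : Prop :=
  ∀ f S, Promise k f S → A.run f = S

/-- On every input (satisfying the promise), the algorithm makes at most `q` queries. -/
def MakesAtMost (A : DetAlgorithm p n X) (k q : ℕ) : Prop :=
  ∀ f S, Promise k f S → A.numQueries f ≤ q

end DetAlgorithm

namespace RandAlgorithm

variable {p n : ℕ} {X : Type*}

/-- On every input, the probability that the algorithm outputs the hidden subgroup is at least
`1 - ε`. -/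
def Solves (A : RandAlgorithm p n X) (k : ℕ) (ε : ℝ) : Prop :=
  ∀ f S, Promise k f S → ENNReal.ofReal (1 - ε) ≤ (A.map fun T => T.run f) S

/-- On every input (satisfying the promise) and for every outcome of the coin tosses, the
algorithm makes at most `q` queries. -/
def MakesAtMost (A : RandAlgorithm p n X) (k q : ℕ) : Prop :=
  ∀ T ∈ A.support, DetAlgorithm.MakesAtMost T k q

end RandAlgorithm

end GSP

/-! Both bounds start by averaging: on any finite family of inputs, an algorithm with error below
1/2 has a tree in its support that is correct on more than half of the family
(`exists_correct_on_majority`). A deterministic algorithm is a point mass with error 0.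

For the bound k, suppose a tree makes fewer than k queries on every input. The queried points do not
span S, so some linear automorphism g fixes them all and moves S. The tree cannot tell f from f ∘ g,
so if it is right on f it is wrong on f ∘ g. Letting g depend only on the transcript makes f ↦ f ∘ g
injective, so at most half of all inputs are solved.

For the bound √(p^(n-k)), take a random k-dimensional W and a coset labelling composed with a random
permutation of X. A nonzero difference lies in W with probability at most 1/M, where M = p^(n-k).
Until two distinct queried points collide, the answers carry no other information about W. By
`card_success_le`, success has probability at most 1/N + q²/M, where N ≥ 3 counts the subspaces;
exceeding 1/2 forces M < 6q². -/

/-! ### Counting permutations with prescribed values. -/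

open scoped Classical in
/-- The number of permutations which take prescribed values on a finite set is at most
`(|X| - |Q|)!`. -/
theorem card_perm_prescribed_le {D X : Type*} [Fintype X] (Q : Finset D) (e a : D → X)
    (ha : Set.InjOn a Q) :
    (Finset.univ.filter fun σ : Equiv.Perm X => ∀ x ∈ Q, σ (e x) = a x).card ≤
      (Fintype.card X - Q.card).factorial := by
  rcases (Finset.univ.filter fun σ : Equiv.Perm X =>
    ∀ x ∈ Q, σ (e x) = a x).eq_empty_or_nonempty with h | ⟨σ₀, hσ₀⟩
  · simp [h]
  · replace hσ₀ : ∀ x ∈ Q, σ₀ (e x) = a x := by simpa using hσ₀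
    have he : Set.InjOn e Q := fun x hx y hy hxy => ha hx hy (by
      rw [← hσ₀ x hx, ← hσ₀ y hy, hxy])
    have hcard : Fintype.card {y // y ∉ Q.image e} = Fintype.card X - Q.card := by
      rw [Fintype.card_subtype_compl, Fintype.card_coe, Finset.card_image_of_injOn he]
    -- Multiplying by `σ₀⁻¹` turns each solution into a permutation fixing `e(Q)` pointwise, that
    -- is, a permutation of the complement.
    rw [← hcard, ← Fintype.card_perm,
      Fintype.card_congr (Equiv.Perm.subtypeEquivSubtypePerm fun y => y ∉ Q.image e),
      Fintype.card_subtype]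
    refine Finset.card_le_card_of_injOn (fun σ => σ₀⁻¹ * σ) (fun σ hσ => ?_)
      (fun σ _ τ _ h => mul_left_cancel h)
    replace hσ : ∀ x ∈ Q, σ (e x) = a x := by simpa using hσ
    simp only [Finset.coe_filter, Finset.mem_univ, true_and, Set.mem_ofPred_eq, not_not,
      Finset.mem_image]
    rintro _ ⟨x, hx, rfl⟩
    rw [Equiv.Perm.mul_apply, hσ x hx, ← hσ₀ x hx,
      ← Equiv.Perm.mul_apply, inv_mul_cancel, Equiv.Perm.one_apply]

open scoped Classical in
theorem card_pairs_prescribed_le {D X I : Type*} [Fintype X] [Fintype I] (J : Finset I)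
    (Q : Finset D) (e : I → D → X) (a : D → X) (ha : Set.InjOn a Q) :
    (Finset.univ.filter fun w : I × Equiv.Perm X =>
      w.1 ∈ J ∧ ∀ x ∈ Q, w.2 (e w.1 x) = a x).card ≤
      J.card * (Fintype.card X - Q.card).factorial := by
  rw [← smul_eq_mul, ← Finset.sum_const]
  refine le_trans (Finset.card_le_card (t := J.biUnion fun i =>
    (Finset.univ.filter fun σ : Equiv.Perm X => ∀ x ∈ Q, σ (e i x) = a x).image
      (Prod.mk i)) ?_)
    (Finset.card_biUnion_le.trans (Finset.sum_le_sum fun i _ => ?_))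
  · rintro ⟨i, σ⟩ hw
    simpa using hw
  · exact Finset.card_image_le.trans (card_perm_prescribed_le Q (e i) a ha)

/-! ### Automorphisms and subspaces of a vector space. -/

section LinearAlgebra

variable {K V : Type*} [Field K] [AddCommGroup V] [Module K V]

/-- The linear automorphisms act transitively on nonzero vectors. -/
theorem exists_linearEquiv_apply_eq_of_ne_zero [FiniteDimensional K V] {x y : V} (hx : x ≠ 0) (hy : y ≠ 0) :
    ∃ g : V ≃ₗ[K] V, g x = y := by
  let ex := LinearEquiv.toSpanNonzeroSingleton K V x hx
  let ey := LinearEquiv.toSpanNonzeroSingleton K V y hy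
  obtain ⟨g, hg⟩ := Submodule.exists_linearEquiv_restrict_eq (ex.symm ≪≫ₗ ey)
  refine ⟨g, ?_⟩
  have hex : (ex 1 : V) = x := by simp [ex]
  rw [← hex, ← hg, LinearEquiv.trans_apply, LinearEquiv.symm_apply_apply]
  simp [ey]

/-- A proper subspace `U` not contained in `W` is moved by an automorphism that fixes `W`. -/
theorem exists_linearEquiv_fixing_moving {W U : Submodule K V} (hUW : ¬ U ≤ W) (hU : U ≠ ⊤) :
    ∃ g : V ≃ₗ[K] V, (∀ w ∈ W, g w = w) ∧ ∃ u ∈ U, g u ∉ U := by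
  obtain ⟨u, huU, huW⟩ := Set.not_subset.mp hUW
  obtain ⟨φ, hφu, hφW⟩ := Submodule.exists_le_ker_of_notMem huW
  obtain ⟨y, hy⟩ : ∃ y, y ∉ U := by
    by_contra! h
    exact hU (eq_top_iff.mpr fun z _ => h z)
  -- The automorphism is the transvection `v ↦ v + φ v • z` with `z = y - (φ y / φ u) • u`. It fixes
  -- `W ≤ ker φ`, and `z ∉ U` because `u ∈ U` and `y ∉ U`.
  have hz : φ (y - (φ y / φ u) • u) = 0 := by
    rw [map_sub, map_smul, smul_eq_mul, div_mul_cancel₀ _ hφu, sub_self]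
  refine ⟨LinearEquiv.transvection hz, fun w hw => ?_, u, huU, fun h => hy ?_⟩
  · rw [LinearEquiv.transvection.apply, LinearMap.mem_ker.mp (hφW hw), zero_smul, add_zero]
  · rw [LinearEquiv.transvection.apply, Submodule.add_mem_iff_right _ huU,
      Submodule.smul_mem_iff _ hφu] at h
    exact (Submodule.sub_mem_iff_left _ (U.smul_mem _ huU)).mp h

theorem exists_submodule_finrank_eq [FiniteDimensional K V] {k : ℕ} (hk : k ≤ Module.finrank K V) :
    ∃ W : Submodule K V, Module.finrank K W = k := by
  let b := Module.finBasis K V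
  refine ⟨Submodule.span K (Set.range (b ∘ Fin.castLE hk)), ?_⟩
  rw [finrank_span_eq_card (b.linearIndependent.comp _ (Fin.castLE_injective hk)), Fintype.card_fin]

end LinearAlgebra

/-! ### Counting subspaces through a vector. -/

section Counting

open scoped Classical

variable {K V : Type*} [Field K] [Fintype K] [AddCommGroup V] [Module K V] [Fintype V]

/-- The number of `k`-dimensional subspaces that contain a given nonzero vector. -/
theorem card_subspaces_through_mul (k : ℕ) {x : V} (hx : x ≠ 0) :
    Fintype.card {W : {W : Submodule K V // Module.finrank K W = k} // x ∈ W.1} *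
        (Fintype.card K ^ Module.finrank K V - 1) =
      Fintype.card {W : Submodule K V // Module.finrank K W = k} * (Fintype.card K ^ k - 1) := by
  -- By transitivity on nonzero vectors the count does not depend on the vector, so incidences can
  -- be counted in two ways.
  have hconst : ∀ y ∈ (Finset.univ.erase (0 : V)),
      (Finset.univ.filter fun W : {W : Submodule K V // Module.finrank K W = k} => y ∈ W.1).card =
      Fintype.card {W : {W : Submodule K V // Module.finrank K W = k} // x ∈ W.1} := by
    intro y hy
    obtain ⟨g, hg⟩ := exists_linearEquiv_apply_eq_of_ne_zero (K := K) (Finset.ne_of_mem_erase hy) hx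
    rw [← Fintype.card_subtype]
    have hmap : ∀ (g : V ≃ₗ[K] V) (W : Submodule K V), Module.finrank K W = k →
        Module.finrank K (W.map (g : V →ₗ[K] V)) = k := fun g W hW => by
      rw [← hW]; exact LinearEquiv.finrank_map_eq g W
    refine Fintype.card_congr
      { toFun := fun W => ⟨⟨_, hmap g _ W.1.2⟩, y, W.2, hg⟩
        invFun := fun W => ⟨⟨_, hmap g.symm _ W.1.2⟩, x, W.2, by simp [← hg]⟩
        left_inv := fun W => ?_
        right_inv := fun W => ?_ }
    · refine Subtype.ext (Subtype.ext ?_)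
      ext v; simp
    · refine Subtype.ext (Subtype.ext ?_)
      ext v; simp
  have hV : (Finset.univ.erase (0 : V)).card = Fintype.card K ^ Module.finrank K V - 1 := by
    rw [Finset.card_erase_of_mem (Finset.mem_univ _), Finset.card_univ,
      Module.card_eq_pow_finrank (K := K)]
  have hW : ∀ W ∈ (Finset.univ : Finset {W : Submodule K V // Module.finrank K W = k}),
      ((Finset.univ.erase (0 : V)).filter fun y => y ∈ W.1).card = Fintype.card K ^ k - 1 := by
    intro W _
    rw [Finset.filter_erase, Finset.card_erase_of_mem (by simp), ← Fintype.card_subtype]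
    have := Module.card_eq_pow_finrank (K := K) (V := W.1)
    rw [W.2] at this
    exact congrArg (· - 1) this
  rw [← hV, mul_comm, ← smul_eq_mul, ← Finset.sum_const, ← Finset.sum_congr rfl hconst]
  simp_rw [Finset.card_filter]
  rw [Finset.sum_comm]
  simp_rw [← Finset.card_filter]
  rw [Finset.sum_congr rfl hW, Finset.sum_const, smul_eq_mul, Finset.card_univ]

end Counting

/-! ### Decision trees and the collision argument. -/

namespace GSP

namespace DecisionTree

variable {D X R : Type*}

/-- The points that the algorithm queries when the queried function is `f`. -/
def queries (f : D → X) : DecisionTree D X R → List D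
  | output _ => []
  | query x next => x :: (next (f x)).queries f

theorem length_queries (f : D → X) (T : DecisionTree D X R) :
    (T.queries f).length = T.numQueries f := by
  induction T with
  | output r => rfl
  | query x next ih => simp [queries, numQueries, ih]

theorem queries_run_eq_of_agree {f g : D → X} (T : DecisionTree D X R)
    (h : ∀ x ∈ T.queries f, g x = f x) : T.queries g = T.queries f ∧ T.run g = T.run f := by
  induction T with
  | output r => exact ⟨rfl, rfl⟩
  | query x next ih =>
    simp only [queries, List.forall_mem_cons] at h
    have := ih (f x) h.2
    simp [queries, run, h.1, this]

open scoped Classical in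
/-- Among the functions `σ ∘ e i` with labels permuted by `σ`, the number of those that are
consistent with the known values `a` on `Q` and for which the algorithm identifies `S i` with `r`
further queries. Here each `e i` separates exactly the cosets of `S i`. -/
theorem card_success_le [AddCommGroup D] [Fintype X] {I : Type*} [Fintype I]
    (S : I → AddSubgroup D) (hS : Function.Injective S) (e : I → D → X)
    (he : ∀ i x y, e i x = e i y ↔ x - y ∈ S i) (N₁ : ℕ)
    (hN₁ : ∀ x ≠ 0, (Finset.univ.filter fun i => x ∈ S i).card ≤ N₁) (q : ℕ)
    (T : DecisionTree D X (AddSubgroup D)) (Q : Finset D) (a : D → X) (ha : Set.InjOn a Q) (r : ℕ)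
    (hr : ∀ i (σ : Equiv.Perm X), (∀ x ∈ Q, σ (e i x) = a x) → T.numQueries (σ ∘ e i) ≤ r)
    (hQr : Q.card + r ≤ q) :
    (Finset.univ.filter fun w : I × Equiv.Perm X =>
      (∀ x ∈ Q, w.2 (e w.1 x) = a x) ∧ T.run (w.2 ∘ e w.1) = S w.1).card ≤
      (Fintype.card X - Q.card).factorial * (1 + N₁ * (r * q)) := by
  induction T generalizing Q a r with
  | output s =>
    have hone : (Finset.univ.filter fun i => S i = s).card ≤ 1 :=
      Finset.card_le_one.mpr fun i hi j hj => hS (by simp_all)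
    refine le_trans (Finset.card_le_card fun w hw => ?_) ((card_pairs_prescribed_le _ Q e a ha).trans
      ((Nat.mul_le_mul_right _ hone).trans ?_))
    · obtain ⟨-, h, hs⟩ := Finset.mem_filter.mp hw
      simpa using ⟨hs.symm, h⟩
    · rw [mul_comm]
      exact Nat.mul_le_mul_left _ (Nat.le_add_right _ _)
  | query x next ih =>
    by_cases hx : x ∈ Q
    -- A repeated query has a known answer, so nothing is learned and `Q` stays unchanged.
    · refine le_trans (Finset.card_le_card fun w hw => ?_)
        (ih (a x) Q a ha r (fun i σ h => ?_) hQr)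
      · obtain ⟨-, h, hs⟩ := Finset.mem_filter.mp hw
        rw [run, Function.comp_apply, h x hx] at hs
        exact Finset.mem_filter.mpr ⟨Finset.mem_univ _, h, hs⟩
      · have := hr i σ h
        simp only [numQueries, Function.comp_apply, h x hx] at this
        exact (Nat.le_succ _).trans this
    obtain _ | r := r
    · rw [Finset.filter_false_of_mem]
      · simp
      · rintro ⟨i, σ⟩ - ⟨h, -⟩
        have := hr i σ h
        simp [numQueries] at this
    -- `B` holds the consistent pairs for which `x` collides with an earlier point; `G b` those
    -- solved after the answer `b`, used for fresh labels `b`. `B` accounts for the growth from `r`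
    -- to `r + 1` in the bound.
    set B := Finset.univ.filter fun w : I × Equiv.Perm X =>
      w.1 ∈ Q.biUnion (fun y => Finset.univ.filter fun i => x - y ∈ S i) ∧
        ∀ z ∈ Q, w.2 (e w.1 z) = a z with hB
    set G := fun b : X => Finset.univ.filter fun w : I × Equiv.Perm X =>
      (∀ z ∈ insert x Q, w.2 (e w.1 z) = Function.update a x b z) ∧
        (next b).run (w.2 ∘ e w.1) = S w.1 with hG
    have hupd : ∀ b, ∀ z ∈ Q, Function.update a x b z = a z := fun b z hz =>
      Function.update_of_ne (ne_of_mem_of_not_mem hz hx) _ _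
    have hcard : (insert x Q).card = Q.card + 1 := Finset.card_insert_of_notMem hx
    have hBle : B.card ≤ (Q.card * N₁) * (Fintype.card X - Q.card).factorial := by
      refine (card_pairs_prescribed_le _ Q e a ha).trans (Nat.mul_le_mul_right _ (Finset.card_biUnion_le_card_mul _ _ _ ?_))
      exact fun y hy => hN₁ _ (sub_ne_zero.mpr fun h => hx (by rwa [h]))
    have hGle : ∀ b ∈ (Q.image a)ᶜ, (G b).card ≤
        (Fintype.card X - (Q.card + 1)).factorial * (1 + N₁ * (r * q)) := by
      intro b hb
      have hinj : Set.InjOn (Function.update a x b) (insert x Q : Finset D) := by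
        rw [Finset.coe_insert, Set.injOn_insert (by simpa using hx)]
        refine ⟨fun y hy z hz h => ha hy hz ?_, ?_⟩
        · rwa [hupd b y hy, hupd b z hz] at h
        · rintro ⟨y, hy, h⟩
          rw [hupd b y hy, Function.update_self] at h
          exact Finset.mem_compl.mp hb (h ▸ Finset.mem_image_of_mem a hy)
      rw [← hcard]
      refine ih b (insert x Q) _ hinj r (fun i σ h => ?_) (by omega)
      · have h1 := hr i σ fun z hz => by rw [h z (Finset.mem_insert_of_mem hz), hupd b z hz]
        have h2 := h x (Finset.mem_insert_self _ _)
        rw [Function.update_self] at h2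
        simpa [numQueries, h2] using h1
    have hsub : (Finset.univ.filter fun w : I × Equiv.Perm X =>
        (∀ z ∈ Q, w.2 (e w.1 z) = a z) ∧
          (query x next).run (w.2 ∘ e w.1) = S w.1) ⊆ B ∪ ((Q.image a)ᶜ).biUnion G := by
      rintro ⟨i, σ⟩ hw
      replace hw := (Finset.mem_filter.mp hw).2
      rw [Finset.mem_union]
      by_cases hcoll : σ (e i x) ∈ Q.image a
      · left
        obtain ⟨y, hy, hyx⟩ := Finset.mem_image.mp hcoll
        rw [← hw.1 y hy] at hyx
        have := (he i x y).mp (σ.injective hyx.symm)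
        simp only [hB, Finset.mem_filter, Finset.mem_univ, true_and, Finset.mem_biUnion]
        exact ⟨⟨y, hy, this⟩, hw.1⟩
      · right
        refine Finset.mem_biUnion.mpr ⟨_, Finset.mem_compl.mpr hcoll, ?_⟩
        simp only [hG, Finset.mem_filter, Finset.mem_univ, true_and, Finset.forall_mem_insert,
          Function.update_self]
        exact ⟨fun z hz => by rw [hupd _ z hz, hw.1 z hz], hw.2⟩
    have hXQ : ((Q.image a)ᶜ).card = Fintype.card X - Q.card := by
      rw [Finset.card_compl, Finset.card_image_of_injOn ha]
    have hunion : (((Q.image a)ᶜ).biUnion G).card ≤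
        (Fintype.card X - Q.card).factorial * (1 + N₁ * (r * q)) := by
      refine (Finset.card_biUnion_le_card_mul _ _ _ hGle).trans ?_
      -- With m = |X| - |Q| fresh labels the factorials combine as m · (m - 1)! ≤ m!, which also
      -- holds for m = 0 under truncated subtraction.
      rw [hXQ, ← mul_assoc, ← Nat.sub_sub]
      refine Nat.mul_le_mul_right _ ?_
      cases Fintype.card X - Q.card <;> simp [Nat.factorial_succ]
    have hq : Q.card * N₁ ≤ N₁ * q := by
      rw [mul_comm]
      exact Nat.mul_le_mul_left _ (by omega)
    calc _ ≤ (B ∪ ((Q.image a)ᶜ).biUnion G).card := Finset.card_le_card hsub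
      _ ≤ _ := Finset.card_union_le _ _
      _ ≤ (N₁ * q) * (Fintype.card X - Q.card).factorial +
          (Fintype.card X - Q.card).factorial * (1 + N₁ * (r * q)) :=
        Nat.add_le_add (hBle.trans (Nat.mul_le_mul_right _ hq)) hunion
      _ = _ := by ring

end DecisionTree

end GSP

/-! ### Inputs satisfying the promise, and averaging over coin tosses. -/

namespace GSP

variable {p n k : ℕ} {X : Type*}

theorem Promise.unique {f : (Fin n → ZMod p) → X} {S S' : AddSubgroup (Fin n → ZMod p)}
    (h : Promise k f S) (h' : Promise k f S') : S = S' := by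
  ext x
  simpa using (h.2 x 0).symm.trans (h'.2 x 0)

theorem Promise.comp_linearEquiv {f : (Fin n → ZMod p) → X} {S : AddSubgroup (Fin n → ZMod p)}
    (h : Promise k f S) (g : (Fin n → ZMod p) ≃ₗ[ZMod p] (Fin n → ZMod p)) :
    Promise k (f ∘ g) (S.comap (g : (Fin n → ZMod p) →+ (Fin n → ZMod p))) := by
  refine ⟨?_, fun x y => ?_⟩
  · rw [← h.1]
    have : AddSubgroup.toZModSubmodule p
        (S.comap (g : (Fin n → ZMod p) →+ (Fin n → ZMod p))) =
        (AddSubgroup.toZModSubmodule p S).map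
          (g.symm : (Fin n → ZMod p) →ₗ[ZMod p] (Fin n → ZMod p)) := by
      ext x
      rw [Submodule.mem_map_equiv]
      rfl
    rw [rank, this]
    exact LinearEquiv.finrank_map_eq g.symm _
  · simp [h.2]

/-- Given any finite family of inputs, a randomized algorithm with error less than `1/2` has an
outcome of the coin tosses which is correct on more than half of the family. -/
theorem RandAlgorithm.exists_correct_on_majority {I : Type*} [Fintype I] [Nonempty I]
    [DecidableEq (AddSubgroup (Fin n → ZMod p))]
    {f : I → (Fin n → ZMod p) → X} {S : I → AddSubgroup (Fin n → ZMod p)}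
    (hf : ∀ i, Promise k (f i) (S i)) {A : RandAlgorithm p n X} {ε : ℝ} (hε : ε < 1 / 2)
    (hA : Solves A k ε) :
    ∃ T ∈ A.support,
      Fintype.card I < 2 * (Finset.univ.filter fun i => T.run (f i) = S i).card := by
  by_contra! hT
  -- The expected number of inputs solved: at least (1 - ε)|I| > |I|/2 input by input, yet at most
  -- |I|/2 tree by tree if the claim fails.
  have hsum : ∑ i, (A.map fun T => T.run (f i)) (S i) =
      ∑' T, A T * (Finset.univ.filter fun i => T.run (f i) = S i).card := by
    simp_rw [PMF.map_apply]
    rw [← Summable.tsum_finsetSum fun _ _ => ENNReal.summable]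
    refine tsum_congr fun T => ?_
    rw [Finset.natCast_card_filter, Finset.mul_sum]
    exact Finset.sum_congr rfl fun i _ => by simp [eq_comm]
  have hupper : 2 * ∑ i, (A.map fun T => T.run (f i)) (S i) ≤ Fintype.card I := by
    rw [hsum, ← ENNReal.tsum_mul_left, ← one_mul (Fintype.card I : ENNReal), ← A.tsum_coe,
      ← ENNReal.tsum_mul_right]
    refine ENNReal.tsum_le_tsum fun T => ?_
    by_cases h : T ∈ A.support
    · rw [mul_left_comm]
      gcongr
      exact_mod_cast hT T h
    · simp [(A.apply_eq_zero_iff T).mpr h]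
  have hlower : Fintype.card I * ENNReal.ofReal (1 - ε) ≤
      ∑ i, (A.map fun T => T.run (f i)) (S i) := by
    rw [← nsmul_eq_mul, ← Finset.card_univ, ← Finset.sum_const]
    exact Finset.sum_le_sum fun i _ => hA _ _ (hf i)
  have h := (mul_le_mul_right hlower 2).trans hupper
  have hI : (0 : ℝ) < Fintype.card I := by exact_mod_cast Fintype.card_pos
  rw [← ENNReal.ofReal_natCast, ← ENNReal.ofReal_mul hI.le, ← ENNReal.ofReal_ofNat 2,
    ← ENNReal.ofReal_mul (by norm_num), ENNReal.ofReal_le_ofReal_iff hI.le] at h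
  nlinarith

/-- A choice of representation of the cosets of each `k`-dimensional subspace by elements of `X`. -/
theorem exists_coset_labelling [Fact p.Prime] [Fintype X] (W : Submodule (ZMod p) (Fin n → ZMod p))
    (hW : Module.finrank (ZMod p) W = k) (hX : p ^ (n - k) ≤ Fintype.card X) :
    ∃ e : (Fin n → ZMod p) → X, ∀ x y, e x = e y ↔ x - y ∈ W := by
  have hcard : Nat.card ((Fin n → ZMod p) ⧸ W) = p ^ (n - k) := by
    have := W.finrank_quotient_add_finrank
    rw [Module.finrank_fin_fun, hW] at this
    rw [Module.natCard_eq_pow_finrank (K := ZMod p), Nat.card_zmod]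
    congr 1
    omega
  have := Fintype.ofFinite ((Fin n → ZMod p) ⧸ W)
  rw [← hcard, Nat.card_eq_fintype_card] at hX
  obtain ⟨ι⟩ := Function.Embedding.nonempty_of_card_le hX
  exact ⟨fun x => ι (Submodule.Quotient.mk x), fun x y => by
    rw [ι.injective.eq_iff, Submodule.Quotient.eq]⟩

theorem rank_toAddSubgroup (W : Submodule (ZMod p) (Fin n → ZMod p)) :
    rank W.toAddSubgroup = Module.finrank (ZMod p) W := by
  rw [rank, Submodule.toAddSubgroup_toZModSubmodule]

theorem exists_promise [Fact p.Prime] [Fintype X] (hkn : k ≤ n)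
    (hX : p ^ (n - k) ≤ Fintype.card X) :
    ∃ (f : (Fin n → ZMod p) → X) (S : AddSubgroup (Fin n → ZMod p)), Promise k f S := by
  obtain ⟨W, hW⟩ := exists_submodule_finrank_eq (K := ZMod p) (V := Fin n → ZMod p) (k := k)
    (by simpa using hkn)
  obtain ⟨e, he⟩ := exists_coset_labelling W hW hX
  exact ⟨e, W.toAddSubgroup, by rw [rank_toAddSubgroup, hW], he⟩

/-- Fewer than `k` vectors span too little to contain `S`, and `S` is proper since `k < n`. -/
theorem exists_linearEquiv_fixing_moving_of_rank [Fact p.Prime] (hkn : k < n)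
    {S : AddSubgroup (Fin n → ZMod p)} (hS : rank S = k) {L : List (Fin n → ZMod p)}
    (hL : L.length < k) :
    ∃ g : (Fin n → ZMod p) ≃ₗ[ZMod p] (Fin n → ZMod p),
      (∀ x ∈ L, g x = x) ∧ ∃ u ∈ S, g u ∉ S := by
  have hspan : Module.finrank (ZMod p) (Submodule.span (ZMod p) {x | x ∈ L}) < k := by
    classical
    rw [← List.coe_toFinset]
    exact (finrank_span_finset_le_card _).trans_lt ((List.toFinset_card_le L).trans_lt hL)
  obtain ⟨g, hg, hu⟩ := exists_linearEquiv_fixing_moving (K := ZMod p)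
    (W := Submodule.span (ZMod p) {x | x ∈ L}) (U := AddSubgroup.toZModSubmodule p S)
    (fun h => by
      have := Submodule.finrank_mono h
      rw [rank] at hS
      omega)
    (fun h => by
      rw [rank, h, finrank_top, Module.finrank_fin_fun] at hS
      omega)
  exact ⟨g, fun x hx => hg x (Submodule.subset_span hx), hu⟩

/-! ### The bound by the rank. -/

/-- An algorithm which makes fewer than `k` queries fails on at least half of all inputs. -/
theorem RandAlgorithm.rank_le_of_solves [Fact p.Prime] [Finite X] (hkn : k < n)
    (hX : p ^ (n - k) ≤ Nat.card X) {A : RandAlgorithm p n X} {ε : ℝ} (hε : ε < 1 / 2)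
    (hA : Solves A k ε) {q : ℕ} (hq : MakesAtMost A k q) : k ≤ q := by
  classical
  have := Fintype.ofFinite X
  rw [Nat.card_eq_fintype_card] at hX
  by_contra! hqk
  let I := {f : (Fin n → ZMod p) → X // ∃ S, Promise k f S}
  choose S hS using fun f : I => f.2
  have : Nonempty I := by
    obtain ⟨f, hf⟩ := exists_promise hkn.le hX
    exact ⟨⟨f, hf⟩⟩
  obtain ⟨T, hT, hmaj⟩ := exists_correct_on_majority hS hε hA
  -- The automorphism is chosen from the queried points and the output alone, so that `f` and `f ∘
  -- g` yield the same one. The identity is only a default value.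
  have hfix : ∀ (L : List (Fin n → ZMod p)) (U : AddSubgroup (Fin n → ZMod p)),
      ∃ g : (Fin n → ZMod p) ≃ₗ[ZMod p] (Fin n → ZMod p), L.length < k → rank U = k →
        (∀ x ∈ L, g x = x) ∧ ∃ u ∈ U, g u ∉ U := by
    intro L U
    by_cases h : L.length < k ∧ rank U = k
    · obtain ⟨g, hg⟩ := exists_linearEquiv_fixing_moving_of_rank hkn h.2 h.1
      exact ⟨g, fun _ _ => hg⟩
    · exact ⟨LinearEquiv.refl _ _, fun h1 h2 => absurd ⟨h1, h2⟩ h⟩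
  choose γ hγ using hfix
  let g (f : I) := γ (T.queries f.1) (T.run f.1)
  let φ (f : I) : I := ⟨f.1 ∘ g f, _, (hS f).comp_linearEquiv (g f)⟩
  have hlen (f : I) : (T.queries f.1).length < k := by
    rw [DecisionTree.length_queries]
    exact (hq T hT f.1 (S f) (hS f)).trans_lt hqk
  have hg (f : I) (hf : T.run f.1 = S f) :=
    hγ (T.queries f.1) (T.run f.1) (hlen f) (by rw [hf]; exact (hS f).1)
  have hrun (f : I) (hf : T.run f.1 = S f) :=
    DecisionTree.queries_run_eq_of_agree (f := f.1) (g := (φ f).1) T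
      fun x hx => congrArg f.1 ((hg f hf).1 x hx)
  have hinj : (Finset.univ.filter fun f : I => T.run f.1 = S f).card ≤
      (Finset.univ.filter fun f : I => ¬ T.run f.1 = S f).card := by
    refine Finset.card_le_card_of_injOn φ (fun f hf => ?_) (fun f hf f' hf' h => ?_)
    · replace hf : T.run f.1 = S f := by simpa using hf
      simp only [Finset.coe_filter, Finset.mem_univ, true_and, Set.mem_ofPred_eq]
      rw [(hrun f hf).2, (hS (φ f)).unique ((hS f).comp_linearEquiv (g f))]
      intro h
      obtain ⟨u, hu, hgu⟩ := (hg f hf).2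
      have hmem : g f u ∈ S f := by
        rw [h] at hu
        exact hu
      rw [← hf] at hmem
      exact hgu hmem
    · replace hf : T.run f.1 = S f := by simpa using hf
      replace hf' : T.run f'.1 = S f' := by simpa using hf'
      -- The tree has the same transcript on `f` and `φ f`, so `φ f` determines `g f`; as `g f` is
      -- invertible, it then determines `f`.
      have hgg : g f = g f' := by
        simp only [g]
        rw [← (hrun f hf).1, ← (hrun f hf).2, h, (hrun f' hf').1, (hrun f' hf').2]
      have h1 : f.1 ∘ g f = f'.1 ∘ g f' := congrArg Subtype.val h
      rw [hgg] at h1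
      exact Subtype.ext ((g f').surjective.injective_comp_right h1)
  have htotal := Finset.card_filter_add_card_filter_not (s := (Finset.univ : Finset I))
    (fun f : I => T.run f.1 = S f)
  rw [Finset.card_univ] at htotal
  omega

/-! ### The bound by the index, and the conclusion. -/

open scoped Classical in
/-- The birthday bound. -/
theorem RandAlgorithm.index_lt_of_solves [Fact p.Prime] [Finite X] (hk : 1 ≤ k) (hkn : k < n)
    (hX : p ^ (n - k) ≤ Nat.card X) {A : RandAlgorithm p n X} {ε : ℝ} (hε : ε < 1 / 2)
    (hA : Solves A k ε) {q : ℕ} (hq : MakesAtMost A k q) : p ^ (n - k) < 6 * q ^ 2 := by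
  have := Fintype.ofFinite X
  rw [Nat.card_eq_fintype_card] at hX
  have hp : 2 ≤ p := (Fact.out : p.Prime).two_le
  let I := {W : Submodule (ZMod p) (Fin n → ZMod p) // Module.finrank (ZMod p) W = k}
  have : Nonempty I := by
    obtain ⟨W, hW⟩ := exists_submodule_finrank_eq (K := ZMod p) (V := Fin n → ZMod p) (k := k)
      (by simpa using hkn.le)
    exact ⟨⟨W, hW⟩⟩
  choose e he using fun W : I => exists_coset_labelling W.1 W.2 hX
  have hpromise (w : I × Equiv.Perm X) : Promise k (w.2 ∘ e w.1) w.1.1.toAddSubgroup :=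
    ⟨by rw [rank_toAddSubgroup, w.1.2], fun x y => by simp [he]⟩
  obtain ⟨T, hT, hmaj⟩ := exists_correct_on_majority hpromise hε hA
  have hthrough (x : Fin n → ZMod p) (hx : x ≠ 0) :=
    card_subspaces_through_mul (K := ZMod p) k hx
  simp only [ZMod.card, Module.finrank_fin_fun] at hthrough
  change ∀ x : Fin n → ZMod p, x ≠ 0 → Fintype.card {W : I // x ∈ W.1} * (p ^ n - 1) =
    Fintype.card I * (p ^ k - 1) at hthrough
  have hpk : 1 < p ^ k := Nat.one_lt_pow (by omega) hp
  have hpn : p ^ n = p ^ (n - k) * p ^ k := by rw [← pow_add, Nat.sub_add_cancel hkn.le]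
  have hM : 2 ≤ p ^ (n - k) := hp.trans (Nat.le_self_pow (by omega) p)
  have hMpos : 0 < p ^ (n - k) := by omega
  have hmul : 0 < p ^ k - 1 := by omega
  have hsub : p ^ n - 1 = p ^ (n - k) * (p ^ k - 1) + (p ^ (n - k) - 1) := by
    rw [hpn, Nat.mul_sub, mul_one]
    have : p ^ (n - k) ≤ p ^ (n - k) * p ^ k := Nat.le_mul_of_pos_right _ (by omega)
    omega
  have hN₁ (x : Fin n → ZMod p) (hx : x ≠ 0) :
      (Finset.univ.filter fun W : I => x ∈ W.1.toAddSubgroup).card ≤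
        Fintype.card I / p ^ (n - k) := by
    rw [Nat.le_div_iff_mul_le hMpos]
    refine Nat.le_of_mul_le_mul_right ?_ hmul
    have h := hthrough x hx
    rw [Fintype.card_subtype, hsub, mul_add, ← mul_assoc] at h
    exact (Nat.le_add_right _ _).trans h.le
  -- Some subspace contains the all-ones vector, so N(p^k - 1) ≥ p^n - 1 > M(p^k - 1), whence N > M
  -- ≥ 2.
  have hN : 3 ≤ Fintype.card I := by
    have : NeZero n := ⟨by omega⟩
    have h := hthrough 1 one_ne_zero
    have hpos : 0 < Fintype.card I * (p ^ k - 1) := Nat.mul_pos Fintype.card_pos hmul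
    rw [← h] at hpos
    have h1 := Nat.le_mul_of_pos_left (p ^ n - 1) (Nat.pos_of_mul_pos_right hpos)
    rw [h, hsub] at h1
    have h2 := Nat.mul_le_mul_right (p ^ k - 1) hM
    by_contra! hlt
    have h3 := Nat.mul_le_mul_right (p ^ k - 1) (Nat.le_of_lt_succ hlt)
    omega
  -- Nothing is known at the start: `Q` is empty and the prescribed values are arbitrary.
  have hsucc := T.card_success_le (fun W : I => W.1.toAddSubgroup)
    (fun W W' h => Subtype.ext (Submodule.toAddSubgroup_injective h)) e he _ hN₁ q ∅ (e this.some)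
    (by simp) q (fun W σ _ => hq T hT _ _ (hpromise (W, σ))) (by simp)
  simp only [Finset.notMem_empty, false_imp_iff, implies_true, true_and, Finset.card_empty,
    Nat.sub_zero] at hsucc
  rw [Fintype.card_prod, Fintype.card_perm] at hmaj
  have hlt : Fintype.card I < 2 * (1 + Fintype.card I / p ^ (n - k) * (q * q)) := by
    refine Nat.lt_of_mul_lt_mul_right (a := (Fintype.card X).factorial) ?_
    calc _ < _ := hmaj
      _ ≤ _ := Nat.mul_le_mul_left 2 hsucc
      _ = _ := by ring
  have hdiv := Nat.div_mul_le_self (Fintype.card I) (p ^ (n - k))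
  generalize Fintype.card I / p ^ (n - k) = N₁ at *
  generalize Fintype.card I = N at *
  generalize p ^ (n - k) = M at *
  by_contra! hcon
  have h1 : N * M < 2 * M + 2 * (N * q ^ 2) := by
    calc N * M < 2 * (1 + N₁ * (q * q)) * M := Nat.mul_lt_mul_of_pos_right hlt hMpos
      _ = 2 * M + 2 * (N₁ * M * q ^ 2) := by ring
      _ ≤ _ := by gcongr
  have h2 := Nat.mul_le_mul_left N hcon
  have h3 := Nat.mul_le_mul_right M hN
  have h4 : N * (6 * q ^ 2) = 6 * (N * q ^ 2) := by ring
  omega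

theorem RandAlgorithm.lower_bound [Fact p.Prime] [Finite X] (hk : 1 ≤ k) (hkn : k < n)
    (hX : p ^ (n - k) ≤ Nat.card X) {A : RandAlgorithm p n X} {ε : ℝ} (hε : ε < 1 / 2)
    (hA : Solves A k ε) {q : ℕ} (hq : MakesAtMost A k q) :
    1 / 3 * max (k : ℝ) (Real.sqrt ((p : ℝ) ^ (n - k))) ≤ (q : ℝ) := by
  have hkq : (k : ℝ) ≤ q := by exact_mod_cast rank_le_of_solves hkn hX hε hA hq
  have hMq : (p : ℝ) ^ (n - k) ≤ 6 * (q : ℝ) ^ 2 := by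
    exact_mod_cast (index_lt_of_solves hk hkn hX hε hA hq).le
  -- The constant 1/3 comes from √6 ≤ 3.
  have hsqrt : Real.sqrt ((p : ℝ) ^ (n - k)) ≤ 3 * q :=
    Real.sqrt_le_iff.mpr ⟨by positivity, by nlinarith [sq_nonneg (q : ℝ)]⟩
  have : max (k : ℝ) (Real.sqrt ((p : ℝ) ^ (n - k))) ≤ 3 * q :=
    max_le (by linarith [(Nat.cast_nonneg q : (0 : ℝ) ≤ q)]) hsqrt
  linarith

theorem DetAlgorithm.Solves.pure {A : DetAlgorithm p n X} (hA : A.Solves k) :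
    RandAlgorithm.Solves (PMF.pure A) k 0 := by
  intro f S hf
  rw [PMF.pure_map, hA f S hf]
  simp

theorem DetAlgorithm.MakesAtMost.pure {A : DetAlgorithm p n X} {q : ℕ}
    (hA : A.MakesAtMost k q) : RandAlgorithm.MakesAtMost (PMF.pure A) k q := by
  intro T hT
  rw [PMF.support_pure, Set.mem_singleton_iff] at hT
  rwa [hT]

end GSP

theorem theorem1 :
    ∃ c : ℝ, 0 < c ∧
      ∀ p n k : ℕ, p.Prime → 1 ≤ k → k < n →
        ∀ (X : Type*) [Finite X], p ^ (n - k) ≤ Nat.card X →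
          (∀ (A : GSP.DetAlgorithm p n X) (q : ℕ),
            GSP.DetAlgorithm.Solves A k → GSP.DetAlgorithm.MakesAtMost A k q →
              c * max (k : ℝ) (Real.sqrt ((p : ℝ) ^ (n - k))) ≤ (q : ℝ)) ∧
          (∀ (ε : ℝ) (A : GSP.RandAlgorithm p n X) (q : ℕ), 0 ≤ ε → ε < 1 / 2 →
            GSP.RandAlgorithm.Solves A k ε → GSP.RandAlgorithm.MakesAtMost A k q →
              c * max (k : ℝ) (Real.sqrt ((p : ℝ) ^ (n - k))) ≤ (q : ℝ)) := by
  refine ⟨1 / 3, by norm_num, fun p n k hp hk hkn X _ hX => ?_⟩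
  have : Fact p.Prime := ⟨hp⟩
  exact ⟨fun A q hA hq =>
      GSP.RandAlgorithm.lower_bound hk hkn hX (by norm_num) hA.pure hq.pure,
    fun ε A q _ hε hA hq => GSP.RandAlgorithm.lower_bound hk hkn hX hε hA hq⟩
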